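/- \textbf{Setting.} An instance consists of $m\ge 1$ identical parallel machines and jobs $1,\dots,n$ with positive integer processing times $p_1,\dots,p_n$. Time starts at $0$ and is divided into unit slots $[t,t+1)$, $t=0,1,2,\dots$. A schedule assigns to each job $j$ a machine and an integer start time $s_j\ge 0$; job $j$ then occupies its machine without interruption during $[s_j,C_j)$, where $C_j=s_j+p_j$, and the makespan of the schedule is $\max_j C_j$ (which is $0$ if there are no jobs). The schedule is feasible if no machine executes two jobs at the same time and at most one job begins in each slot (bounded job start parameter $g=1$). Let $T^*$ be the minimum makespan of a feasible schedule. Longest Processing Time First (LPT) considers the jobs one after the other in an order of non-increasing processing times (ties broken arbitrarily). Each job is started in the earliest available slot and placed on a machine on which it does not overlap with the jobs scheduled before it; here a slot is available if, among the jobs scheduled before, fewer than $m$ are being executed in this slot and none begins in it. \textbf{Theorem.} Suppose that the instance is long, i.e. $p_j\ge m$ for every job $j$. Then, for every order of the jobs by non-increasing processing times, LPT can schedule all the jobs in this way (at least one such schedule exists), and each schedule that it can produce is feasible and has makespan $T\le \frac53\,T^*$. That is, for $g=1$, LPT is $5/3$-approximate for long instances. -/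

import Mathlib

namespace BJSP

/-- An instance `⟨m, J⟩` of bounded job start scheduling: `m ≥ 1` identical parallel machines and
`n` jobs, job `j` having a positive integer processing time `p j`. -/
structure Instance where
  /-- number of jobs -/
  n : ℕ
  /-- number of machines -/
  m : ℕ
  /-- processing times -/
  p : Fin n → ℕ
  m_pos : 0 < m
  p_pos : ∀ j, 0 < p j

/-- An instance is long if every processing time is at least the number of machines. -/
def Instance.IsLong (I : Instance) : Prop :=
  ∀ j, I.m ≤ I.p j

/-- A (not necessarily feasible) schedule assigns to every job a machine and a start time.
Time begins at `0` and is divided into the unit slots `[t, t + 1)`, `t = 0, 1, 2, …`. -/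
structure Schedule (I : Instance) where
  machine : Fin I.n → Fin I.m
  start : Fin I.n → ℕ

namespace Schedule

variable {I : Instance}

/-- Completion time `C_j = s_j + p_j`; job `j` occupies its machine during `[s_j, C_j)`. -/
def completion (S : Schedule I) (j : Fin I.n) : ℕ :=
  S.start j + I.p j

/-- The makespan `max_j C_j` (equal to `0` if there are no jobs). -/
def makespan (S : Schedule I) : ℕ :=
  Finset.univ.sup S.completion

/-- The jobs of `K` that are alive during the slot `[t, t + 1)`. -/
def alive (S : Schedule I) (K : Finset (Fin I.n)) (t : ℕ) : Finset (Fin I.n) :=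
  {j ∈ K | S.start j ≤ t ∧ t < S.completion j}

/-- The jobs of `K` that begin in the slot `[t, t + 1)`. -/
def beginning (S : Schedule I) (K : Finset (Fin I.n)) (t : ℕ) : Finset (Fin I.n) :=
  {j ∈ K | S.start j = t}

/-- Jobs `i` and `j` do not collide: they run on different machines or during disjoint time
intervals. -/
def Compatible (S : Schedule I) (i j : Fin I.n) : Prop :=
  S.machine i = S.machine j → S.completion i ≤ S.start j ∨ S.completion j ≤ S.start i

/-- Feasibility: every machine executes at most one job at a time, and at most `g` jobs begin in
every time slot. -/
def Feasible (S : Schedule I) (g : ℕ) : Prop :=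
  (∀ i j, i ≠ j → S.Compatible i j) ∧ ∀ t, (S.beginning Finset.univ t).card ≤ g

/-- When exactly the jobs of `K` have been scheduled, a slot is available if fewer than `m` of them
are alive in it and fewer than `g` of them begin in it. -/
def Available (S : Schedule I) (g : ℕ) (K : Finset (Fin I.n)) (t : ℕ) : Prop :=
  (S.alive K t).card < I.m ∧ (S.beginning K t).card < g

/-- `S` is an outcome of greedy scheduling in the order `σ 0, σ 1, …, σ (n - 1)`: each job starts in
the earliest slot that is available with respect to the jobs preceding it in the order, on a machine
on which it does not collide with any of these jobs. -/
def IsGreedy (S : Schedule I) (g : ℕ) (σ : Equiv.Perm (Fin I.n)) : Prop :=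
  ∀ k : Fin I.n,
    IsLeast {t | S.Available g ((Finset.Iio k).image σ) t} (S.start (σ k)) ∧
      ∀ i < k, S.Compatible (σ i) (σ k)

end Schedule

/-- `σ` lists the jobs by non-increasing processing time (ties broken arbitrarily). -/
def Instance.IsLPTOrder (I : Instance) (σ : Equiv.Perm (Fin I.n)) : Prop :=
  Antitone (I.p ∘ σ)

/-- The minimum makespan of a feasible schedule. -/
noncomputable def Instance.optMakespan (I : Instance) (g : ℕ) : ℕ :=
  sInf {T | ∃ S : Schedule I, S.Feasible g ∧ S.makespan = T}

end BJSP

/-!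
LPT starts the jobs in order of time, one after the other, and before the start of a job every slot
is full (all `m` machines busy) or has a job beginning in it. Let the job `σ k` finish last among all
jobs, let `p` be its length, `s` its start, and let `M` be the optimal makespan. Only the jobs up to
`σ k` matter, and `p` is the least of their lengths.

If `3 * p ≤ M`, an area argument applies. In a run of non-full slots one job begins per slot, and as
jobs have length at least `m`, none of these ends within `m` slots; so the run has fewer than `m`
slots. The number of idle machines drops by at most one per slot, so in a run that is followed by a
full slot these numbers are at most `1, 2, 3, …`, read backwards from its end.
Hence a non-full slot has idleness at most `m / 2` on average, up to a bounded error from a run cut off at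
`s` (`idle_sum_le`). There are at most `k` such slots because each has a beginning job
(`IsGreedy.mul_start_le`). The optimal schedule itself loses `m * (m - 1) / 2` of its area at the
beginning (`Feasible.two_mul_sum_add_le`), and a polynomial inequality in `m ≤ p ≤ M / 3` remains
(`IsGreedy.completion_le_of_three_mul_le`).

If `M < 3 * p`, the optimal schedule runs at most two jobs per machine, and jobs longer than `M - p`
run alone (`Feasible.card_big_add_card_le`). So many of the first `m` jobs have length at most
`M - p`, which frees machines early enough for `s + p ≤ M + k` (`IsGreedy.completion_le_add`). Two jobs
per machine give `k < 2 * m`, and distinct start times give `M ≥ k + p ≥ k + m`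
(`Feasible.card_add_le`); together `k ≤ 2 * M / 3`.
-/

namespace BJSP

/-! ### Idle time in runs of non-full slots -/

/-- In a sequence of slots with `a t` busy machines, suppose that the number of busy machines grows
by at most one from slot to slot and that the `(L + 1)`-st slot of every run of non-full slots has
at least `L + 1` busy machines. Then a run of `L` non-full slots that is followed by a full slot
has total idleness at most `L * (L + 1) / 2 ≤ L * m / 2`; a run cut off at the end exceeds
`L * m / 2` by at most `(m - 1) ^ 2 / 8`. -/
theorem idle_sum_le (a : ℕ → ℕ) (m s : ℕ) (hm : 0 < m)
    (hstep : ∀ t, a (t + 1) ≤ a t + 1)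
    (hrun : ∀ t < s, ∀ L, L < m → L ≤ t → (∀ u, t ≤ u + L → u ≤ t → a u < m) → L + 1 ≤ a t) :
    8 * ∑ t ∈ Finset.range s, (m - a t) + 2 * m ≤
      4 * m * ((Finset.range s).filter (fun t => a t < m)).card + m ^ 2 + 1 := by
  -- `L` is the length of the current run of non-full slots and `h` the idleness of its last slot.
  have key : ∀ t ≤ s, ∃ L h, L + h ≤ m ∧ L ≤ t ∧ (∀ u, t ≤ u + L → u < t → a u < m) ∧
      (0 < L → a (t - 1) + h = m ∧ 0 < h) ∧
      2 * ∑ u ∈ Finset.range t, (m - a u) + m * L + L ≤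
        m * ((Finset.range t).filter (fun u => a u < m)).card + 2 * L * h + L * L := by
    intro t
    induction t with
    | zero => intro _; exact ⟨0, 0, by simp⟩
    | succ t ih =>
      intro ht
      obtain ⟨L, h, hLh, hLt, hu, hpos, hsum⟩ := ih (by omega)
      rw [Finset.sum_range_succ, Finset.range_add_one, Finset.filter_insert]
      by_cases hat : a t < m
      · rw [if_pos hat, Finset.card_insert_of_notMem (by simp)]
        have hLm : L < m := by
          rcases Nat.eq_zero_or_pos L with h0 | h0
          · omega
          · have := hpos h0; omega
        have hrt : L + 1 ≤ a t := by
          refine hrun t (by omega) L hLm hLt fun u h1 h2 => ?_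
          rcases h2.lt_or_eq with h3 | h3
          · exact hu u h1 h3
          · exact h3 ▸ hat
        refine ⟨L + 1, m - a t, by omega, by omega, ?_, ?_, ?_⟩
        · intro u h1 h2
          rcases (Nat.lt_succ_iff.mp h2).lt_or_eq with h3 | h3
          · exact hu u (by omega) h3
          · exact h3 ▸ hat
        · intro _
          simp only [Nat.add_sub_cancel]
          omega
        · have hh : L * h ≤ L * (m - a t) + L := by
            rcases Nat.eq_zero_or_pos L with h0 | h0
            · simp [h0]
            · have h1 := (hpos h0).1
              have h2 := hstep (t - 1)
              rw [Nat.sub_add_cancel (by omega)] at h2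
              have : h ≤ (m - a t) + 1 := by omega
              nlinarith
          nlinarith
      · rw [if_neg hat]
        refine ⟨0, 0, by omega, by omega, by intros; omega, by simp, ?_⟩
        have h0 : m - a t = 0 := by omega
        rw [h0]
        rcases Nat.eq_zero_or_pos L with hL | hL
        · subst hL; simpa using hsum
        · have h1 := hpos hL
          have h2 := hstep (t - 1)
          rw [Nat.sub_add_cancel (by omega)] at h2
          have h3 : h = 1 := by omega
          subst h3
          nlinarith
  obtain ⟨L, h, hLh, -, -, -, hsum⟩ := key s le_rfl
  have h1 : L * h + L * L ≤ L * m := by nlinarith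
  zify at *
  nlinarith [sq_nonneg ((m : ℤ) - 1 - 2 * L)]

namespace Schedule

variable {I : Instance}

theorem mem_alive {S : Schedule I} {K : Finset (Fin I.n)} {t : ℕ} {i : Fin I.n} :
    i ∈ S.alive K t ↔ i ∈ K ∧ S.start i ≤ t ∧ t < S.start i + I.p i := by
  unfold alive
  rw [Finset.mem_filter]
  rfl

theorem mem_beginning {S : Schedule I} {K : Finset (Fin I.n)} {t : ℕ} {i : Fin I.n} :
    i ∈ S.beginning K t ↔ i ∈ K ∧ S.start i = t := by
  simp [beginning]

/-! ### Counting alive jobs -/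

theorem sum_card_alive (S : Schedule I) (K : Finset (Fin I.n)) (N : ℕ) :
    ∑ t ∈ Finset.range N, (S.alive K t).card =
      ∑ i ∈ K, ((Finset.range N).filter
        (fun t => S.start i ≤ t ∧ t < S.completion i)).card := by
  simp only [alive, Finset.card_filter]
  exact Finset.sum_comm

theorem sum_card_alive_le (S : Schedule I) (K : Finset (Fin I.n)) (N : ℕ) :
    ∑ t ∈ Finset.range N, (S.alive K t).card ≤ ∑ i ∈ K, I.p i := by
  rw [sum_card_alive]
  refine Finset.sum_le_sum fun i _ => ?_
  calc _ ≤ (Finset.Ico (S.start i) (S.completion i)).card :=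
        Finset.card_le_card fun t => by simp
    _ = I.p i := by simp [completion]

theorem sum_card_alive_eq (S : Schedule I) (K : Finset (Fin I.n)) (N : ℕ)
    (hN : ∀ i ∈ K, S.completion i ≤ N) :
    ∑ t ∈ Finset.range N, (S.alive K t).card = ∑ i ∈ K, I.p i := by
  rw [sum_card_alive]
  refine Finset.sum_congr rfl fun i hi => ?_
  have h : (Finset.range N).filter (fun t => S.start i ≤ t ∧ t < S.completion i) =
      Finset.Ico (S.start i) (S.completion i) := by
    ext t
    have := hN i hi
    simp only [Finset.mem_filter, Finset.mem_range, Finset.mem_Ico]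
    omega
  rw [h]
  simp [completion]

theorem card_beginning_le_one {S : Schedule I} {K : Finset (Fin I.n)}
    (hinj : Set.InjOn S.start K) (t : ℕ) : (S.beginning K t).card ≤ 1 := by
  refine Finset.card_le_one.mpr fun i hi j hj => ?_
  rw [mem_beginning] at hi hj
  exact hinj hi.1 hj.1 (hi.2.trans hj.2.symm)

theorem card_alive_succ_le {S : Schedule I} {K : Finset (Fin I.n)}
    (hinj : Set.InjOn S.start K) (t : ℕ) :
    (S.alive K (t + 1)).card ≤ (S.alive K t).card + 1 := by
  calc _ ≤ (S.alive K t ∪ S.beginning K (t + 1)).card := by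
        refine Finset.card_le_card fun i => ?_
        simp only [Finset.mem_union, mem_alive, mem_beginning]
        grind
    _ ≤ _ := (Finset.card_union_le _ _).trans
        (Nat.add_le_add_left (card_beginning_le_one hinj _) _)

/-! ### Lower bounds on the makespan of feasible schedules -/

theorem Feasible.start_injective {S : Schedule I} (hS : S.Feasible 1) :
    Function.Injective S.start := by
  intro i j hij
  refine Finset.card_le_one.mp (hS.2 (S.start j)) i ?_ j ?_ <;> simp [mem_beginning, hij]

theorem Feasible.card_alive_le {S : Schedule I} (hS : S.Feasible 1) (K : Finset (Fin I.n))
    (t : ℕ) : (S.alive K t).card ≤ I.m := by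
  rw [← Fintype.card_fin I.m, ← Finset.card_univ]
  refine Finset.card_le_card_of_injOn S.machine (by simp) fun i hi j hj hij => ?_
  by_contra hne
  have h := hS.1 i j hne hij
  simp only [Finset.mem_coe, mem_alive] at hi hj
  simp only [completion] at h
  omega

theorem Feasible.card_alive_le_succ {S : Schedule I} (hS : S.Feasible 1)
    (K : Finset (Fin I.n)) (t : ℕ) : (S.alive K t).card ≤ t + 1 := by
  rw [← Finset.card_range (t + 1)]
  refine Finset.card_le_card_of_injOn S.start (fun i hi => ?_) hS.start_injective.injOn
  simp only [Finset.mem_coe, mem_alive] at hi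
  simp only [Finset.coe_range, Set.mem_Iio]
  omega

/-- The area bound: in the first slots only `t + 1` machines can be busy, so that
`m * (m - 1) / 2` of the area `m * M` is lost. -/
theorem Feasible.two_mul_sum_add_le {S : Schedule I} (hS : S.Feasible 1)
    (K : Finset (Fin I.n)) {M : ℕ} (hM : ∀ i ∈ K, S.completion i ≤ M) (hm : I.m ≤ M) :
    2 * ∑ i ∈ K, I.p i + I.m * (I.m - 1) ≤ 2 * I.m * M := by
  rw [← sum_card_alive_eq S K M hM]
  obtain ⟨d, rfl⟩ := Nat.exists_eq_add_of_le hm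
  rw [Finset.sum_range_add]
  have h1 : ∑ t ∈ Finset.range I.m, (S.alive K t).card ≤
      ∑ t ∈ Finset.range I.m, (t + 1) :=
    Finset.sum_le_sum fun t _ => hS.card_alive_le_succ K t
  have h2 : ∑ t ∈ Finset.range d, (S.alive K (I.m + t)).card ≤ d * I.m := by
    simpa using Finset.sum_le_card_nsmul (Finset.range d) _ I.m
      fun t _ => hS.card_alive_le K (I.m + t)
  have h3 := Finset.sum_range_id_mul_two I.m
  rw [Finset.sum_add_distrib] at h1
  simp only [Finset.sum_const, Finset.card_range, smul_eq_mul, mul_one] at h1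
  have h4 : I.m * (I.m - 1) + I.m = I.m * I.m := by
    rw [← Nat.mul_succ, Nat.succ_eq_add_one, Nat.sub_add_cancel I.m_pos]
  nlinarith

/-- Since the start times are distinct, one of the jobs starts at time `#K - 1` or later. -/
theorem Feasible.card_add_le {S : Schedule I} (hS : S.Feasible 1) {K : Finset (Fin I.n)}
    (hK : K.Nonempty) {M p : ℕ} (hM : ∀ i ∈ K, S.completion i ≤ M) (hp : ∀ i ∈ K, p ≤ I.p i) :
    K.card + p ≤ M + 1 := by
  have hpM : p ≤ M := by
    obtain ⟨i, hi⟩ := hK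
    have h1 := hM i hi
    have h2 := hp i hi
    simp only [completion] at h1
    omega
  have : K.card ≤ (Finset.range (M - p + 1)).card := by
    refine Finset.card_le_card_of_injOn S.start (fun i hi => ?_) hS.start_injective.injOn
    have h1 := hM i hi
    have h2 := hp i hi
    simp only [completion] at h1
    simp only [Finset.coe_range, Set.mem_Iio]
    omega
  rw [Finset.card_range] at this
  omega

theorem Feasible.sum_machine_le {S : Schedule I} (hS : S.Feasible 1) {F : Finset (Fin I.n)}
    {M : ℕ} (hM : ∀ i ∈ F, S.completion i ≤ M) {μ : Fin I.m} (hμ : ∀ i ∈ F, S.machine i = μ) :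
    ∑ i ∈ F, I.p i ≤ M := by
  rw [← sum_card_alive_eq S F M hM]
  have h : ∀ t ∈ Finset.range M, (S.alive F t).card ≤ 1 := by
    refine fun t _ => Finset.card_le_one.mpr fun i hi j hj => ?_
    rw [mem_alive] at hi hj
    by_contra hne
    have h := hS.1 i j hne ((hμ i hi.1).trans (hμ j hj.1).symm)
    simp only [completion] at h
    omega
  simpa using Finset.sum_le_card_nsmul _ _ 1 h

/-- If all jobs are longer than a third of the makespan `M`, then every machine runs at most two
jobs, and a job longer than `M - p` is alone on its machine. -/
theorem Feasible.card_big_add_card_le {S : Schedule I} (hS : S.Feasible 1)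
    {K : Finset (Fin I.n)} {M p : ℕ} (hM : ∀ i ∈ K, S.completion i ≤ M)
    (hp : ∀ i ∈ K, p ≤ I.p i) (hp3 : M < 3 * p) :
    (K.filter (fun i => M < I.p i + p)).card + K.card ≤ 2 * I.m := by
  rw [Finset.card_eq_sum_card_fiberwise (f := S.machine) (s := K.filter (fun i => M < I.p i + p))
      (t := Finset.univ) (by simp),
    Finset.card_eq_sum_card_fiberwise (f := S.machine) (s := K)
      (t := Finset.univ) (by simp), ← Finset.sum_add_distrib]
  have key : ∀ μ ∈ (Finset.univ : Finset (Fin I.m)),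
      ((K.filter (fun i => M < I.p i + p)).filter (fun i => S.machine i = μ)).card +
        (K.filter (fun i => S.machine i = μ)).card ≤ 2 := by
    intro μ _
    set F := K.filter (fun i => S.machine i = μ) with hF
    have hFK : F ⊆ K := Finset.filter_subset _ _
    have hsum : ∑ i ∈ F, I.p i ≤ M :=
      hS.sum_machine_le (fun i hi => hM i (hFK hi)) (μ := μ)
        fun i hi => (Finset.mem_filter.mp hi).2
    rw [Finset.filter_comm, ← hF]
    rcases Finset.eq_empty_or_nonempty (F.filter (fun i => M < I.p i + p)) with he | ⟨b, hb⟩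
    · rw [he, Finset.card_empty, zero_add]
      have h : F.card * p ≤ ∑ i ∈ F, I.p i :=
        Finset.card_nsmul_le_sum F I.p p fun i hi => hp i (hFK hi)
      by_contra hc
      have : 3 * p ≤ F.card * p := Nat.mul_le_mul_right p (by omega)
      omega
    · obtain ⟨hbF, hbig⟩ := Finset.mem_filter.mp hb
      have h : (F.erase b).card * p ≤ ∑ i ∈ F.erase b, I.p i :=
        Finset.card_nsmul_le_sum (F.erase b) I.p p
          fun i hi => hp i (hFK (Finset.mem_of_mem_erase hi))
      rw [Finset.card_erase_of_mem hbF] at h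
      have h2 := Finset.add_sum_erase F I.p hbF
      have h3 : F.card ≤ 1 := by
        by_contra hc
        have : 1 * p ≤ (F.card - 1) * p := Nat.mul_le_mul_right p (by omega)
        omega
      have h4 := Finset.card_filter_le F (fun i => M < I.p i + p)
      omega
  have := Finset.sum_le_card_nsmul _ _ 2 key
  simp only [Finset.card_univ, Fintype.card_fin, smul_eq_mul] at this
  omega

/-! ### Greedy schedules -/

theorem available_one_iff {S : Schedule I} {K : Finset (Fin I.n)} {t : ℕ} :
    S.Available 1 K t ↔ (S.alive K t).card < I.m ∧ ∀ i ∈ K, S.start i ≠ t := by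
  simp [Available, beginning, Finset.filter_eq_empty_iff]

/-- Scheduling further jobs never makes a slot available. -/
theorem Available.anti {S : Schedule I} {K K' : Finset (Fin I.n)} {t : ℕ} (hK : K ⊆ K')
    (h : S.Available 1 K' t) : S.Available 1 K t := by
  rw [available_one_iff] at *
  refine ⟨(Finset.card_le_card fun i hi => ?_).trans_lt h.1, fun i hi => h.2 i (hK hi)⟩
  rw [mem_alive] at *
  exact ⟨hK hi.1, hi.2⟩

theorem image_Iio_subset {n : ℕ} (σ : Equiv.Perm (Fin n)) {i k : Fin n} (h : i ≤ k) :
    (Finset.Iio i).image σ ⊆ (Finset.Iio k).image σ :=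
  Finset.image_subset_image (Finset.Iio_subset_Iio h)

theorem start_lt_of_isLeast {S : Schedule I} {σ : Equiv.Perm (Fin I.n)} {i k : Fin I.n} {t : ℕ}
    (hi : IsLeast {t | S.Available 1 ((Finset.Iio i).image σ) t} (S.start (σ i)))
    (hik : i < k) (ht : S.Available 1 ((Finset.Iio k).image σ) t) : S.start (σ i) < t := by
  refine lt_of_le_of_ne (hi.2 (ht.anti (image_Iio_subset σ hik.le))) ?_
  exact (available_one_iff.mp ht).2 _ (Finset.mem_image_of_mem σ (Finset.mem_Iio.mpr hik))

theorem IsGreedy.start_lt {S : Schedule I} {σ : Equiv.Perm (Fin I.n)} (hS : S.IsGreedy 1 σ)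
    {i k : Fin I.n} (hik : i < k) : S.start (σ i) < S.start (σ k) :=
  start_lt_of_isLeast (hS i).1 hik (hS k).1.1

theorem IsGreedy.start_injective {S : Schedule I} {σ : Equiv.Perm (Fin I.n)}
    (hS : S.IsGreedy 1 σ) : Function.Injective S.start := by
  have h : StrictMono (S.start ∘ σ) := fun i k hik => hS.start_lt hik
  intro i j hij
  have := h.injective (a₁ := σ.symm i) (a₂ := σ.symm j) (by simpa using hij)
  simpa using this

theorem IsGreedy.feasible {S : Schedule I} {σ : Equiv.Perm (Fin I.n)} (hS : S.IsGreedy 1 σ) :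
    S.Feasible 1 := by
  refine ⟨fun i j hij => ?_, fun t => card_beginning_le_one hS.start_injective.injOn t⟩
  obtain ⟨a, rfl⟩ := σ.surjective i
  obtain ⟨b, rfl⟩ := σ.surjective j
  rcases lt_trichotomy a b with h | h | h
  · exact (hS b).2 a h
  · exact absurd (congrArg σ h) hij
  · exact fun hm => ((hS a).2 b h hm.symm).symm

theorem alive_congr {S S' : Schedule I} {K : Finset (Fin I.n)}
    (h : ∀ i ∈ K, S.start i = S'.start i) (t : ℕ) : S.alive K t = S'.alive K t := by
  ext i
  simp only [mem_alive]
  exact and_congr_right fun hi => by rw [h i hi]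

theorem available_congr {S S' : Schedule I} {K : Finset (Fin I.n)}
    (h : ∀ i ∈ K, S.start i = S'.start i) (t : ℕ) :
    S.Available 1 K t ↔ S'.Available 1 K t := by
  rw [available_one_iff, available_one_iff, alive_congr h]
  exact and_congr_right fun _ => forall₂_congr fun i hi => by rw [h i hi]

theorem exists_available (S : Schedule I) (K : Finset (Fin I.n)) : ∃ t, S.Available 1 K t := by
  have hle : ∀ i ∈ K, S.completion i ≤ K.sup S.completion := fun i hi => Finset.le_sup hi
  refine ⟨K.sup S.completion, available_one_iff.mpr ⟨?_, fun i hi => ?_⟩⟩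
  · have : S.alive K (K.sup S.completion) = ∅ := by
      ext i
      simp only [mem_alive, Finset.notMem_empty, iff_false]
      intro h
      have := hle i h.1
      simp only [completion] at *
      omega
    rw [this]
    exact I.m_pos
  · have h1 := hle i hi
    have h2 := I.p_pos i
    simp only [completion] at *
    omega

/-- The greedy procedure never gets stuck: the jobs scheduled before have all started by the
earliest available slot, so a machine that is idle in this slot stays idle afterwards. -/
theorem exists_isGreedy (I : Instance) (σ : Equiv.Perm (Fin I.n)) :
    ∃ S : Schedule I, S.IsGreedy 1 σ := by
  have key : ∀ N ≤ I.n, ∃ S : Schedule I, ∀ k : Fin I.n, k.val < N →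
      IsLeast {t | S.Available 1 ((Finset.Iio k).image σ) t} (S.start (σ k)) ∧
        ∀ i < k, S.Compatible (σ i) (σ k) := by
    intro N
    induction N with
    | zero => exact fun _ => ⟨⟨fun _ => ⟨0, I.m_pos⟩, fun _ => 0⟩, fun k hk => by omega⟩
    | succ N ih =>
      intro hN
      obtain ⟨S, hS⟩ := ih (by omega)
      set k : Fin I.n := ⟨N, hN⟩ with hk
      set K := (Finset.Iio k).image σ with hK
      classical
      set t := Nat.find (S.exists_available K) with ht
      have htA : S.Available 1 K t := Nat.find_spec (S.exists_available K)
      obtain ⟨μ, hμ⟩ : ∃ μ, μ ∉ (S.alive K t).image S.machine := by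
        by_contra! hall
        have h1 : (S.alive K t).card < I.m := (available_one_iff.mp htA).1
        have h2 := Finset.card_le_card (fun μ _ => hall μ : Finset.univ ⊆ _)
        have h3 := Finset.card_image_le (s := S.alive K t) (f := S.machine)
        rw [Finset.card_univ, Fintype.card_fin] at h2
        omega
      let S' : Schedule I :=
        ⟨Function.update S.machine (σ k) μ, Function.update S.start (σ k) t⟩
      have hne : ∀ i < k, σ i ≠ σ k := fun i hi => σ.injective.ne hi.ne
      have hs : ∀ i < k, S'.start (σ i) = S.start (σ i) :=
        fun i hi => Function.update_of_ne (hne i hi) _ _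
      have hmach : ∀ i < k, S'.machine (σ i) = S.machine (σ i) :=
        fun i hi => Function.update_of_ne (hne i hi) _ _
      have hsk : S'.start (σ k) = t := Function.update_self ..
      have hmk : S'.machine (σ k) = μ := Function.update_self ..
      have hav : ∀ j ≤ k, ∀ u, S'.Available 1 ((Finset.Iio j).image σ) u ↔
          S.Available 1 ((Finset.Iio j).image σ) u := by
        intro j hj u
        refine available_congr (fun i hi => ?_) u
        obtain ⟨a, ha, rfl⟩ := Finset.mem_image.mp hi
        exact hs a ((Finset.mem_Iio.mp ha).trans_le hj)
      refine ⟨S', fun j hj => ?_⟩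
      rcases (Nat.lt_succ_iff.mp hj).lt_or_eq with h | h
      · have hjk : j < k := h
        obtain ⟨h1, h2⟩ := hS j h
        refine ⟨?_, fun i hi => ?_⟩
        · simp only [hav j hjk.le]
          rw [hs j hjk]
          exact h1
        · have := h2 i hi
          simp only [Compatible, completion] at this ⊢
          rwa [hs j hjk, hs i (hi.trans hjk), hmach j hjk, hmach i (hi.trans hjk)]
      · obtain rfl : j = k := Fin.ext h
        refine ⟨?_, fun i hi => ?_⟩
        · rw [hsk]
          exact ⟨(hav k le_rfl t).2 htA, fun u hu => Nat.find_min' _ ((hav k le_rfl u).1 hu)⟩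
        · intro hm
          rw [hmach i hi, hmk] at hm
          left
          change S'.start (σ i) + I.p (σ i) ≤ S'.start (σ k)
          rw [hs i hi, hsk]
          by_contra hc
          refine hμ (Finset.mem_image.mpr ⟨σ i, mem_alive.mpr ⟨?_, ?_, by omega⟩, hm⟩)
          · exact Finset.mem_image_of_mem σ (Finset.mem_Iio.mpr hi)
          · exact (start_lt_of_isLeast (hS i hi).1 hi htA).le
  obtain ⟨S, hS⟩ := key I.n le_rfl
  exact ⟨S, fun k => hS k k.isLt⟩

/-! ### Slots before the start of a greedily scheduled job -/

/-- Each slot before the start of a greedily scheduled job is full or has a job beginning in it. -/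
theorem IsGreedy.full_or_exists_start_eq {S : Schedule I} {σ : Equiv.Perm (Fin I.n)}
    (hS : S.IsGreedy 1 σ) (k : Fin I.n) {t : ℕ} (ht : t < S.start (σ k)) :
    I.m ≤ (S.alive ((Finset.Iio k).image σ) t).card ∨
      ∃ i ∈ (Finset.Iio k).image σ, S.start i = t := by
  have h : ¬ S.Available 1 ((Finset.Iio k).image σ) t := fun h => absurd ((hS k).1.2 h) (by omega)
  rw [available_one_iff] at h
  by_contra! hc
  exact h hc

theorem card_image_Iio {n : ℕ} (σ : Equiv.Perm (Fin n)) (k : Fin n) :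
    ((Finset.Iio k).image σ).card = k.val := by
  rw [Finset.card_image_of_injective _ σ.injective, Fin.card_Iio]

/-- While fewer than `m` jobs are scheduled, no slot is full, so the jobs start one per slot. -/
theorem IsGreedy.start_le_of_lt {S : Schedule I} {σ : Equiv.Perm (Fin I.n)}
    (hS : S.IsGreedy 1 σ) {k : Fin I.n} (hk : k.val < I.m) : S.start (σ k) ≤ k.val := by
  have h : Finset.range (S.start (σ k)) ⊆ ((Finset.Iio k).image σ).image S.start := by
    intro t ht
    rcases hS.full_or_exists_start_eq k (Finset.mem_range.mp ht) with h | ⟨i, hi, h⟩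
    · have h2 := Finset.card_filter_le ((Finset.Iio k).image σ)
        (fun j => S.start j ≤ t ∧ t < S.completion j)
      rw [card_image_Iio] at h2
      simp only [alive] at h
      omega
    · exact Finset.mem_image.mpr ⟨i, hi, h⟩
  have h1 := Finset.card_le_card h
  have h2 := Finset.card_image_le (s := (Finset.Iio k).image σ) (f := S.start)
  rw [card_image_Iio] at h2
  rw [Finset.card_range] at h1
  omega

/-! ### Short last job -/

/-- The area argument for the greedy schedule: the first `s` slots offer `m * s` units, of which
the jobs of `K` use at most their total processing time and `idle_sum_le` bounds the rest. -/
theorem IsGreedy.mul_start_le {S : Schedule I} (hI : I.IsLong) {σ : Equiv.Perm (Fin I.n)}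
    (hS : S.IsGreedy 1 σ) (k : Fin I.n) :
    8 * (I.m * S.start (σ k)) + 2 * I.m ≤
      8 * ∑ i ∈ (Finset.Iio k).image σ, I.p i + 4 * I.m * k.val + I.m ^ 2 + 1 := by
  set K := (Finset.Iio k).image σ with hK
  set s := S.start (σ k) with hs
  have hinj : Set.InjOn S.start K := hS.start_injective.injOn
  have hbeg : ∀ t < s, (S.alive K t).card < I.m → ∃ i ∈ K, S.start i = t := by
    intro t ht h
    exact (hS.full_or_exists_start_eq k ht).resolve_left (not_le.mpr h)
  have hidle := idle_sum_le (fun t => (S.alive K t).card) I.m s I.m_pos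
    (card_alive_succ_le hinj) (by
      intro t ht L hL hLt hu
      -- The jobs begun in the last `L + 1 ≤ m` slots are all still alive, being of length `≥ m`.
      have h : Finset.Icc (t - L) t ⊆ (S.alive K t).image S.start := by
        intro u hut
        rw [Finset.mem_Icc] at hut
        obtain ⟨i, hi, rfl⟩ := hbeg u (by omega) (hu u (by omega) hut.2)
        have := hI i
        exact Finset.mem_image_of_mem _ (mem_alive.mpr ⟨hi, hut.2, by omega⟩)
      have h1 := Finset.card_le_card h
      have h2 := Finset.card_image_le (s := S.alive K t) (f := S.start)
      rw [Nat.card_Icc] at h1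
      omega)
  have hB : ((Finset.range s).filter (fun t => (S.alive K t).card < I.m)).card ≤ k.val := by
    rw [← card_image_Iio σ k, ← hK]
    refine le_trans (Finset.card_le_card fun t ht => ?_) (Finset.card_image_le (f := S.start))
    rw [Finset.mem_filter, Finset.mem_range] at ht
    obtain ⟨i, hi, h⟩ := hbeg t ht.1 ht.2
    exact Finset.mem_image.mpr ⟨i, hi, h⟩
  have harea : I.m * s ≤ ∑ t ∈ Finset.range s, (S.alive K t).card +
      ∑ t ∈ Finset.range s, (I.m - (S.alive K t).card) := by
    rw [← Finset.sum_add_distrib]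
    have := Finset.card_nsmul_le_sum (Finset.range s)
      (fun t => (S.alive K t).card + (I.m - (S.alive K t).card)) I.m fun t _ => by omega
    rw [Finset.card_range, smul_eq_mul, mul_comm] at this
    exact this
  have hal := sum_card_alive_le S K s
  have := Nat.mul_le_mul_left (4 * I.m) hB
  omega

theorem IsGreedy.completion_le_of_three_mul_le {S : Schedule I} (hI : I.IsLong)
    {σ : Equiv.Perm (Fin I.n)} (hS : S.IsGreedy 1 σ) (k : Fin I.n) {M : ℕ}
    (hmin : ∀ i ≤ k, I.p (σ k) ≤ I.p (σ i))
    (harea : 2 * ∑ i ∈ (Finset.Iic k).image σ, I.p i + I.m * (I.m - 1) ≤ 2 * I.m * M)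
    (h3 : 3 * I.p (σ k) ≤ M) :
    3 * S.completion (σ k) ≤ 5 * M := by
  have hst := hS.mul_start_le hI k
  have hlong := hI (σ k)
  have hm := I.m_pos
  have hsum : ∑ i ∈ (Finset.Iic k).image σ, I.p i =
      I.p (σ k) + ∑ i ∈ (Finset.Iio k).image σ, I.p i := by
    rw [← Finset.Iio_insert, Finset.image_insert, Finset.sum_insert]
    simp
  have hlow : k.val * I.p (σ k) ≤ ∑ i ∈ (Finset.Iio k).image σ, I.p i := by
    have := Finset.card_nsmul_le_sum ((Finset.Iio k).image σ) I.p (I.p (σ k)) (by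
      intro i hi
      obtain ⟨a, ha, rfl⟩ := Finset.mem_image.mp hi
      exact hmin a (Finset.mem_Iio.mp ha).le)
    rwa [card_image_Iio, smul_eq_mul] at this
  rw [hsum] at harea
  simp only [completion]
  generalize ∑ i ∈ (Finset.Iio k).image σ, I.p i = A at *
  generalize I.p (σ k) = p at *
  generalize S.start (σ k) = s at *
  generalize k.val = n at *
  generalize I.m = q at *
  obtain ⟨m, rfl⟩ : ∃ m, q = m + 1 := ⟨q - 1, by omega⟩
  simp only [Nat.add_sub_cancel] at *
  obtain ⟨d, rfl⟩ := Nat.exists_eq_add_of_le hlong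
  obtain ⟨e, rfl⟩ := Nat.exists_eq_add_of_le h3
  -- Eliminate `s`, then `n`, then `A`; what is left has nonnegative coefficients in `m`, `d`, `e`.
  have e1 := Nat.mul_le_mul_left (3 * (m + 1 + d)) hst
  have e2 := Nat.mul_le_mul_left (12 * (m + 1)) hlow
  have e3 := Nat.mul_le_mul_left (12 * (m + 1 + d) + 6 * (m + 1)) harea
  refine le_of_mul_le_mul_left (a := 8 * (m + 1) * (m + 1 + d)) ?_ (by positivity)
  zify at *
  have e4 : (0 : ℤ) ≤ 3 * m ^ 3 + 33 * m ^ 2 + 21 * m ^ 2 * d + 4 * m ^ 2 * e + 54 * m +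
      96 * m * d + 8 * m * e + 24 * m * d ^ 2 + 16 * m * d * e + 24 + 72 * d + 4 * e +
      48 * d ^ 2 + 16 * d * e := by positivity
  linarith

/-! ### Long last job -/

/-- If the last job is longer than a third of the optimum `M`, compare with the last slot `τ`
without a beginning job: one of the first `m` jobs that has length at most `M - p` is not
completed before it. -/
theorem IsGreedy.completion_le_add {S : Schedule I}
    {σ : Equiv.Perm (Fin I.n)} (hS : S.IsGreedy 1 σ) (k : Fin I.n) {M : ℕ}
    (hpM : I.p (σ k) ≤ M)
    (hbig : (((Finset.Iic k).image σ).filter (fun i => M < I.p i + I.p (σ k))).card +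
      (k.val + 1) ≤ 2 * I.m) :
    S.completion (σ k) ≤ M + k.val := by
  set K := (Finset.Iio k).image σ with hK
  set s := S.start (σ k) with hs
  have hKcard : K.card = k.val := card_image_Iio σ k
  simp only [completion]
  rw [← hs]
  by_cases hall : ∀ t < s, ∃ i ∈ K, S.start i = t
  · have h1 : Finset.range s ⊆ K.image S.start := fun t ht =>
      Finset.mem_image.mpr (hall t (Finset.mem_range.mp ht))
    have h2 := (Finset.card_le_card h1).trans Finset.card_image_le
    rw [Finset.card_range] at h2
    omega
  classical
  set W := (Finset.range s).filter (fun t => ∀ i ∈ K, S.start i ≠ t) with hW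
  have hWne : W.Nonempty := by
    push Not at hall
    obtain ⟨t, ht, h⟩ := hall
    exact ⟨t, Finset.mem_filter.mpr ⟨Finset.mem_range.mpr ht, h⟩⟩
  obtain ⟨hτs, hτ⟩ := Finset.mem_filter.mp (W.max'_mem hWne)
  set τ := W.max' hWne with hτdef
  rw [Finset.mem_range] at hτs
  have hafter : ∀ t, τ < t → t < s → ∃ i ∈ K, S.start i = t := by
    intro t h1 h2
    by_contra! hc
    have := W.le_max' t (Finset.mem_filter.mpr ⟨Finset.mem_range.mpr h2, hc⟩)
    omega
  have hfull : I.m ≤ (S.alive K τ).card :=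
    (hS.full_or_exists_start_eq k hτs).resolve_right fun ⟨i, hi, h⟩ => hτ i hi h
  -- The jobs of `K` are alive in slot `τ`, begin after it, or are completed before it.
  set late := K.filter (fun i => τ < S.start i) with hlate
  set done := K.filter (fun i => S.completion i ≤ τ) with hdone
  have hlatecard : s - 1 - τ ≤ late.card := by
    have h1 : Finset.Ioo τ s ⊆ late.image S.start := by
      intro t ht
      rw [Finset.mem_Ioo] at ht
      obtain ⟨i, hi, rfl⟩ := hafter t ht.1 ht.2
      exact Finset.mem_image_of_mem _ (Finset.mem_filter.mpr ⟨hi, ht.1⟩)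
    have h2 := (Finset.card_le_card h1).trans Finset.card_image_le
    rw [Nat.card_Ioo] at h2
    omega
  have hpart : (S.alive K τ).card + late.card + done.card ≤ K.card := by
    rw [← Finset.card_union_of_disjoint, ← Finset.card_union_of_disjoint]
    · refine Finset.card_le_card fun i hi => ?_
      simp only [Finset.mem_union, mem_alive, hlate, hdone, Finset.mem_filter] at hi
      tauto
    · rw [Finset.disjoint_left]
      intro i h1 h2
      simp only [Finset.mem_union, mem_alive, hlate, hdone, Finset.mem_filter] at h1 h2
      simp only [completion] at h2
      omega
    · rw [Finset.disjoint_left]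
      intro i h1 h2
      simp only [mem_alive, hlate, Finset.mem_filter] at h1 h2
      omega
  set F := (K.filter (fun i => (σ.symm i).val < I.m)) with hF
  set big := ((Finset.Iic k).image σ).filter (fun i => M < I.p i + I.p (σ k)) with hbigdef
  have hFcard : I.m ≤ F.card := by
    have hmn : I.m < I.n := by have := k.isLt; omega
    have h1 : (Finset.Iio (⟨I.m, hmn⟩ : Fin I.n)).image σ ⊆ F := by
      intro i hi
      obtain ⟨a, ha, rfl⟩ := Finset.mem_image.mp hi
      rw [Finset.mem_Iio, Fin.lt_def] at ha
      refine Finset.mem_filter.mpr ⟨Finset.mem_image_of_mem _ (Finset.mem_Iio.mpr ?_), by simpa⟩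
      rw [Fin.lt_def]
      simp only at ha
      omega
    have h2 := Finset.card_le_card h1
    rwa [card_image_Iio] at h2
  obtain ⟨i, hiF, hi⟩ : ∃ i ∈ F, i ∉ big ∪ done := by
    by_contra! hc
    have h1 := Finset.card_le_card (fun i hi => hc i hi : F ⊆ big ∪ done)
    have h2 := Finset.card_union_le big done
    omega
  obtain ⟨hiK, him⟩ := Finset.mem_filter.mp hiF
  rw [Finset.mem_union, not_or] at hi
  have hstart : S.start i ≤ I.m - 1 := by
    have := hS.start_le_of_lt him
    simp only [Equiv.apply_symm_apply] at this
    omega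
  have hsmall : I.p i + I.p (σ k) ≤ M := by
    by_contra hc
    refine hi.1 (Finset.mem_filter.mpr ⟨?_, by omega⟩)
    exact Finset.image_subset_image Finset.Iio_subset_Iic_self hiK
  have hnd : τ < S.start i + I.p i := by
    by_contra hc
    exact hi.2 (Finset.mem_filter.mpr ⟨hiK, by simp only [completion]; omega⟩)
  have := I.m_pos
  omega

end Schedule

end BJSP

/-! ### The approximation ratio -/

open BJSP BJSP.Schedule in
theorem mainTheorem3 (I : BJSP.Instance) (hI : I.IsLong)
    (σ : Equiv.Perm (Fin I.n)) (hσ : I.IsLPTOrder σ) :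
    (∃ S : BJSP.Schedule I, S.IsGreedy 1 σ) ∧
      ∀ S : BJSP.Schedule I, S.IsGreedy 1 σ →
        S.Feasible 1 ∧ (S.makespan : ℝ) ≤ 5 / 3 * (I.optMakespan 1 : ℝ) := by
  refine ⟨exists_isGreedy I σ, fun S hS => ⟨hS.feasible, ?_⟩⟩
  obtain ⟨O, hO, hOM⟩ : ∃ O : Schedule I, O.Feasible 1 ∧ O.makespan = I.optMakespan 1 :=
    Nat.sInf_mem (s := {T | ∃ S : Schedule I, S.Feasible 1 ∧ S.makespan = T})
      ⟨S.makespan, S, hS.feasible, rfl⟩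
  suffices h : 3 * S.makespan ≤ 5 * I.optMakespan 1 by
    have : (3 * S.makespan : ℝ) ≤ 5 * I.optMakespan 1 := by exact_mod_cast h
    linarith
  set M := I.optMakespan 1 with hMdef
  have hM : ∀ i, O.completion i ≤ M := fun i => hOM ▸ Finset.le_sup (Finset.mem_univ i)
  have key : ∀ k : Fin I.n, 3 * S.completion (σ k) ≤ 5 * M := by
    intro k
    have hmin : ∀ i ≤ k, I.p (σ k) ≤ I.p (σ i) := fun i hi => hσ hi
    have hmin' : ∀ i ∈ (Finset.Iic k).image σ, I.p (σ k) ≤ I.p i := by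
      intro i hi
      obtain ⟨a, ha, rfl⟩ := Finset.mem_image.mp hi
      exact hmin a (Finset.mem_Iic.mp ha)
    have hcard : ((Finset.Iic k).image σ).card = k.val + 1 := by
      rw [Finset.card_image_of_injective _ σ.injective, Fin.card_Iic]
    have hlong := hI (σ k)
    rcases le_or_gt (3 * I.p (σ k)) M with h3 | h3
    · exact hS.completion_le_of_three_mul_le hI k hmin
        (hO.two_mul_sum_add_le _ (fun i _ => hM i) (by omega)) h3
    · have h1 := hO.card_add_le (K := (Finset.Iic k).image σ) ⟨σ k, by simp⟩
        (fun i _ => hM i) hmin'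
      have h2 := hO.card_big_add_card_le (K := (Finset.Iic k).image σ)
        (fun i _ => hM i) hmin' h3
      rw [hcard] at h1 h2
      have h4 := hS.completion_le_add k (M := M) (by omega) h2
      omega
  have hsup : S.makespan ≤ 5 * M / 3 := by
    refine Finset.sup_le fun i _ => ?_
    have := key (σ.symm i)
    rw [Equiv.apply_symm_apply] at this
    omega
  omega
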